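/- **Setting.** Let $E$ be a finite set and $X=(X_t)_{t\ge0}$ a right-continuous time-homogeneous continuous-time Markov chain on $E$ with Markov generator $\mathcal Q=(Q(x,y))_{x,y\in E}$ and laws $(\mathbb P_x)_{x\in E}$, $\mathbb P_x(X_0=x)=1$. Let $\beta>0$ and let $\psi,\phi:E\to\mathbb R$ satisfy $0\le\psi\le\phi$. Stopping times are taken with respect to the natural filtration of $X$, with values in $[0,\infty]$. Write $\mathcal Q[f](x)=\sum_yQ(x,y)f(y)$, $h(A)=\inf\{t\ge0:X_t\in A\}$ for $A\subset E$, $\{\phi=\psi\}=\{x\in E:\phi(x)=\psi(x)\}$ and similarly for other conditions, and $$R_x(\tau,\gamma)=\mathbb E_x\big[e^{-\beta\tau}\psi(X_\tau)\mathbf 1_{\tau\le\gamma}+e^{-\beta\gamma}\phi(X_\gamma)\mathbf 1_{\tau>\gamma}\big],$$ where $e^{-\beta\eta}f(X_\eta)=0$ on $\{\eta=\infty\}$. A function $V$ on $E$ is the value of the game if $V(x)=\inf_\gamma\sup_\tau R_x(\tau,\gamma)=\sup_\tau\inf_\gamma R_x(\tau,\gamma)$ for all $x$. A pair of stopping times $(\tau^*,\gamma^*)$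 is a Nash equilibrium if $R_x(\tau,\gamma^*)\le R_x(\tau^*,\gamma^*)\le R_x(\tau^*,\gamma)$ for all $x$ and all stopping times $\tau,\gamma$. Let $V_0(x)=\sup_\tau\mathbb E_x[e^{-\beta\tau}\psi(X_\tau)]$. **Algorithm with initial set $S_1\supset\{\phi=\psi\}$.** For $k\ge1$, given $S_k$, put $\gamma_k=h(S_k)$ and $V_k(x)=\sup_\tau R_x(\tau,\gamma_k)$. Further let $D^{(1)}_k=\{\mathcal Q[\psi]-\beta\psi\le0\}\setminus S_k$, and for $n\ge1$ let $V^{(n)}_k(x)=R_x(h(D^{(n)}_k),\gamma_k)$ and $D^{(n+1)}_k=D^{(n)}_k\cap\{\mathcal Q[V^{(n)}_k]-\beta V^{(n)}_k\le0\}$; put $D_k=\bigcap_nD^{(n)}_k$ and $\tau_k=h(D_k)$. Then let $S_{k+1}=\big(S_k\cap\{\mathcal Q[V_k]-\beta V_k\ge0\}\big)\cup\{\phi=\psi\}$. Finally $D_\infty=\bigcup_kD_k$, $S_\infty=\bigcap_kS_k$, $V_\infty=\inf_kV_k$, $\tau_\infty=h(D_\infty)$, $\gamma_\infty=h(S_\infty)$.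 Let $(D_k,\tau_k,S_k,\gamma_k,V_k)_{k\in\{1,2,\dots\}\cup\{\infty\}}$ be produced from $S_1=\{V_0>\phi\}\cup\{\phi=\psi\}$, and let $(\widetilde D_k,\widetilde\tau_k,\widetilde S_k,\widetilde\gamma_k,\widetilde V_k)_{k\in\{1,2,\dots\}\cup\{\infty\}}$ be produced in the same way from $\widetilde S_1=\{V_0\ge\phi\}$. **Proposition.** $S_1\subset\widetilde S_1$, the game has a value $V$, and the following hold. (A) For every $k\in\{1,2,\dots\}\cup\{\infty\}$: $\widetilde V_k(x)=R_x(\widetilde\tau_k,\widetilde\gamma_k)$ for all $x\in E$; $\widetilde D_k\cap\widetilde S_k=\emptyset$; $\widetilde V_k=\psi$ on $\widetilde D_k$, $\widetilde V_k=\phi$ on $\widetilde S_k$, and $\widetilde V_k>\psi$ outside $\widetilde D_k\cup\widetilde S_k$; $\mathcal Q[\widetilde V_k]-\beta\widetilde V_k\le0$ on $\widetilde D_k$ and $\mathcal Q[\widetilde V_k]-\beta\widetilde V_k=0$ outside $\widetilde D_k\cup\widetilde S_k$; $\psi\le\widetilde V_k\le\phi$. For every finite $k\ge1$, $\widetilde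 V_{k+1}\le\widetilde V_k$. The sequence $(\widetilde D_k)_{k\ge1}$ is increasing, $(\widetilde S_k)_{k\ge1}$ is decreasing, and $\widetilde V_k\to\widetilde V_\infty$ pointwise. (B) The pair $\big(\widetilde\tau_\infty\wedge h(\{\phi=\psi\}),\widetilde\gamma_\infty\big)$ is a Nash equilibrium, and $\widetilde\tau_\infty\wedge h(\{\phi=\psi\})=h(\{\phi=\psi\}\cup\widetilde D_\infty)$. Moreover $\widetilde V_\infty=\phi$ on $\widetilde S_\infty$ and $\widetilde V_\infty=\psi<\phi$ on $\widetilde D_\infty$. (C) (i) $\widetilde D_\infty=D_\infty$ and $\widetilde D_\infty\cup\{\phi=\psi\}=\{V=\psi\}$; in particular $\widetilde\tau_\infty=\tau_\infty$. (ii) $\widetilde V_\infty=V_\infty=V$. (iii) $\widetilde V_k<\phi$ outside $\widetilde S_k$ for all $k\in\{1,2,\dots\}\cup\{\infty\}$. (iv) $\psi<\widetilde V_k<\phi$ outside $\widetilde D_k\cup\widetilde S_k$ for all $k\in\{1,2,\dots\}\cup\{\infty\}$. (v) $\widetilde S_\infty=\{V=\phi\}$. -/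

import Mathlib

open MeasureTheory Filter Topology
open scoped NNReal

/-- A right-continuous homogeneous continuous-time Markov chain `X` on a finite state space `E`,
given on one measurable space `Ω` together with a family of probability measures `P x` under which
it starts at `x`, and admitting the Markov generator `Q`. -/
structure MarkovChain (E Ω : Type*) [Fintype E] [MeasurableSpace E] [MeasurableSpace Ω] where
  /-- the generator matrix -/
  Q : Matrix E E ℝ
  row_sum : ∀ x, ∑ y, Q x y = 0
  off_diag_nonneg : ∀ x y, x ≠ y → 0 ≤ Q x y
  /-- the process -/
  X : ℝ≥0 → Ω → E
  measurable_X : ∀ t, Measurable (X t)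
  /-- right-continuity of every path, for the discrete topology of `E` -/
  rightCont : ∀ ω t, ∀ᶠ s in 𝓝[≥] t, X s ω = X t ω
  /-- the law of the chain started at a given state -/
  P : E → Measure Ω
  isProb : ∀ x, IsProbabilityMeasure (P x)
  start : ∀ x, P x {ω | X 0 ω = x} = 1
  /-- the time-homogeneous Markov property with respect to the natural filtration -/
  markov : ∀ (x y z : E) (s t : ℝ≥0) (A : Set Ω),
    MeasurableSet[⨆ r ≤ s, MeasurableSpace.comap (X r) inferInstance] A →
    P x (A ∩ {ω | X s ω = y} ∩ {ω | X (s + t) ω = z}) =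
      P x (A ∩ {ω | X s ω = y}) * P y {ω | X t ω = z}
  /-- `Q` is the derivative at time `0` of the transition matrices `P x (X t = y)` -/
  generator : ∀ x y, HasDerivWithinAt
    (fun t : ℝ => (P x).real {ω | X t.toNNReal ω = y}) (Q x y) (Set.Ici 0) 0

/-- The data of a discounted zero-sum stopping game driven by a Markov chain: the discount rate
`β > 0` and the payoffs `0 ≤ ψ ≤ φ`. -/
structure StoppingGame (E Ω : Type*) [Fintype E] [MeasurableSpace E] [MeasurableSpace Ω]
    extends MarkovChain E Ω where
  β : ℝ
  β_pos : 0 < β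
  ψ : E → ℝ
  φ : E → ℝ
  ψ_nonneg : ∀ x, 0 ≤ ψ x
  ψ_le_φ : ∀ x, ψ x ≤ φ x

namespace StoppingGame

noncomputable section

variable {E Ω : Type*} [Fintype E] [MeasurableSpace E] [MeasurableSpace Ω]
  (G : StoppingGame E Ω)

/-- The natural filtration of the chain. -/
def filtration : Filtration ℝ≥0 (inferInstance : MeasurableSpace Ω) where
  seq t := ⨆ r ≤ t, MeasurableSpace.comap (G.X r) inferInstance
  mono' _ _ hst := biSup_mono fun _ hr => le_trans hr hst
  le' _ := iSup₂_le fun r _ => (G.measurable_X r).comap_le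

/-- The set of all stopping times, with values in `[0, ∞]`. -/
def stoppingTimes : Set (Ω → WithTop ℝ≥0) := {τ | IsStoppingTime G.filtration τ}

/-- The first hitting time `inf {t ≥ 0 | X t ∈ A}` (equal to `⊤` if `A` is never hit). -/
def hit (A : Set E) : Ω → WithTop ℝ≥0 := hittingAfter G.X A 0

/-- `exp (-β η) f (X_η)`, with the convention that it is `0` where `η = ∞`. -/
def reward (f : E → ℝ) (η : Ω → WithTop ℝ≥0) (ω : Ω) : ℝ :=
  match η ω with
  | ⊤ => 0
  | (t : ℝ≥0) => Real.exp (-(G.β * t)) * f (G.X t ω)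

open scoped Classical in
/-- The expected payoff `R_x(τ, γ)`. -/
def payoff (τ γ : Ω → WithTop ℝ≥0) (x : E) : ℝ :=
  ∫ ω, (if τ ω ≤ γ ω then G.reward G.ψ τ ω else G.reward G.φ γ ω) ∂(G.P x)

/-- The upper value `inf_γ sup_τ R_x(τ, γ)`. -/
def upperValue (x : E) : ℝ := ⨅ γ : G.stoppingTimes, ⨆ τ : G.stoppingTimes, G.payoff τ γ x

/-- The lower value `sup_τ inf_γ R_x(τ, γ)`. -/
def lowerValue (x : E) : ℝ := ⨆ τ : G.stoppingTimes, ⨅ γ : G.stoppingTimes, G.payoff τ γ x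

/-- The game has a value and `V` is its value function. -/
def IsValue (V : E → ℝ) : Prop := G.lowerValue = V ∧ G.upperValue = V

/-- `(τ', γ')` is a Nash equilibrium (saddle point) in stopping times. -/
def IsNash (τ' γ' : Ω → WithTop ℝ≥0) : Prop :=
  τ' ∈ G.stoppingTimes ∧ γ' ∈ G.stoppingTimes ∧
    ∀ x, ∀ τ ∈ G.stoppingTimes, ∀ γ ∈ G.stoppingTimes,
      G.payoff τ γ' x ≤ G.payoff τ' γ' x ∧ G.payoff τ' γ' x ≤ G.payoff τ' γ x

/-- The function `Q[f] - β f`. -/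
def gen (f : E → ℝ) (x : E) : ℝ := ∑ y, G.Q x y * f y - G.β * f x

/-- The one-player value function `V_0(x) = sup_τ E_x[exp (-β τ) ψ(X_τ)]`. -/
def onePlayerValue (x : E) : ℝ := ⨆ τ : G.stoppingTimes, ∫ ω, G.reward G.ψ τ ω ∂(G.P x)

/-- The set `{φ = ψ}`. -/
def eqSet : Set E := {x | G.φ x = G.ψ x}

/-- The inner loop for a given stopping set `S` of the inf-player: `innerD S n` is the
`(n+1)`-st of the decreasing candidate stopping sets of the sup-player. -/
def innerD (S : Set E) : ℕ → Set E
  | 0 => {x | G.gen G.ψ x ≤ 0} ∩ Sᶜ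
  | n + 1 => {x | G.gen (G.payoff (G.hit (innerD S n)) (G.hit S)) x ≤ 0} ∩ innerD S n

/-- The result of the inner loop: the intersection of the decreasing sets `innerD S n`. -/
def limitD (S : Set E) : Set E := ⋂ n, G.innerD S n

/-- The function `x ↦ sup_τ R_x(τ, h(S))`. -/
def bestReply (S : Set E) (x : E) : ℝ := ⨆ τ : G.stoppingTimes, G.payoff τ (G.hit S) x

/-- The outer loop started from the set `I`. Iterations are counted from `0` here, so that
`setS I k`, `setD I k`, `fnV I k` are `S_{k+1}`, `D_{k+1}`, `V_{k+1}` when `S_1 = I`. -/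
def setS (I : Set E) : ℕ → Set E
  | 0 => I
  | k + 1 => (setS I k ∩ {x | 0 ≤ G.gen (G.bestReply (setS I k)) x}) ∪ G.eqSet

/-- The stopping sets of the sup-player produced by the algorithm started from `I`. -/
def setD (I : Set E) (k : ℕ) : Set E := G.limitD (G.setS I k)

/-- The functions produced by the algorithm started from `I`. -/
def fnV (I : Set E) (k : ℕ) : E → ℝ := G.bestReply (G.setS I k)

/-- The limit set `S_∞` of the algorithm started from `I`. -/
def limS (I : Set E) : Set E := ⋂ k, G.setS I k

/-- The limit set `D_∞` of the algorithm started from `I`. -/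
def limD (I : Set E) : Set E := ⋃ k, G.setD I k

/-- The limit function `V_∞ = inf_k V_k` of the algorithm started from `I`. -/
def limV (I : Set E) (x : E) : ℝ := ⨅ k, G.fnV I k x

/-- The original initial set `{V_0 > φ} ∪ {φ = ψ}`. -/
def init : Set E := {x | G.φ x < G.onePlayerValue x} ∪ G.eqSet

/-- The modified initial set `{V_0 ≥ φ}`. -/
def init' : Set E := {x | G.φ x ≤ G.onePlayerValue x}

end

end StoppingGame

namespace StoppingGame

set_option linter.unusedSectionVars false

noncomputable section

variable {E Ω : Type*} [Fintype E] [MeasurableSpace E] [MeasurableSpace Ω]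
  (G : StoppingGame E Ω)

/-! ### The generator: minimum principle and the Dirichlet problem -/

/-! Write `gen f` for Q[f] - βf. Since β > 0 and `E` is finite, `gen` satisfies a minimum principle.
This gives comparison (`le_of_gen_le`), unique solvability of Dirichlet problems
(`exists_dirichlet`), and a strictness device (`gen_le_of_touch`): ordered functions that agree at a
point have ordered generators there. Probability enters only through Dynkin's inequality
(`integral_reward_le`), obtained by sampling on grids from the Markov property and right-continuity.
It turns sign conditions on `gen` into bounds on expected payoffs (`payoff_le`, `le_payoff`) and
identifies payoffs of hitting times with Dirichlet solutions.

After that the argument is finite-dimensional. Removing from a stopping set of the sup-player the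
points where `gen` is positive raises the payoff, and the loop stops at the best reply to h(S)
(`isBestReply_bestReply`). Removing from S the points where `gen` of the best reply is negative
lowers the best reply. Both loops stabilize because `E` has finitely many subsets. At a stationary S
the best reply is superharmonic off S and subharmonic off D ∪ {φ = ψ}, which makes the two hitting
times a saddle point (`IsStationary.isNash_and_isValue`).

Both initial sets lead to stationary sets, so both limits equal the unique value, and D∞ can be read
off from that value (`IsStationary.mem_D_iff`). S∞ cannot in general. The start {V₀ ≥ φ} has V₀ < φ
outside it, and this strictness survives every iteration (`IsInitialSet.fnV_lt_φ`), whence S∞ = {V =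
φ}. -/

lemma gen_sub (f g : E → ℝ) (x : E) : G.gen (f - g) x = G.gen f x - G.gen g x := by
  simp only [gen, Pi.sub_apply, mul_sub, Finset.sum_sub_distrib]
  ring

lemma gen_neg (f : E → ℝ) (x : E) : G.gen (-f) x = - G.gen f x := by
  simp only [gen, Pi.neg_apply, mul_neg, Finset.sum_neg_distrib]
  ring

lemma gen_add (f g : E → ℝ) (x : E) : G.gen (f + g) x = G.gen f x + G.gen g x := by
  simp only [gen, Pi.add_apply, mul_add, Finset.sum_add_distrib]
  ring

lemma gen_smul (c : ℝ) (f : E → ℝ) (x : E) : G.gen (c • f) x = c * G.gen f x := by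
  simp only [gen, Pi.smul_apply, smul_eq_mul, mul_sub, Finset.mul_sum]
  congr 1
  · exact Finset.sum_congr rfl fun _ _ => by ring
  · ring

/-- Zero row sums allow u(x) to be subtracted inside the sum. The diagonal term then vanishes and
every off-diagonal term is nonnegative. -/
lemma neg_mul_le_gen_of_isMin {u : E → ℝ} {x : E} (h : ∀ y, u x ≤ u y) :
    -(G.β * u x) ≤ G.gen u x := by
  have key : 0 ≤ ∑ y, G.Q x y * (u y - u x) := by
    refine Finset.sum_nonneg fun y _ => ?_
    rcases eq_or_ne x y with rfl | hxy
    · simp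
    · exact mul_nonneg (G.off_diag_nonneg x y hxy) (sub_nonneg.2 (h y))
  have : ∑ y, G.Q x y * (u y - u x) = ∑ y, G.Q x y * u y := by
    simp only [mul_sub, Finset.sum_sub_distrib, ← Finset.sum_mul, G.row_sum, zero_mul, sub_zero]
  rw [gen, ← this]
  linarith

/-- Minimum principle. -/
lemma nonneg_of_gen_nonpos {u : E → ℝ} {A : Set E} (hA : ∀ x ∈ A, 0 ≤ u x)
    (hu : ∀ x, x ∉ A → G.gen u x ≤ 0) (x : E) : 0 ≤ u x := by
  have : Nonempty E := ⟨x⟩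
  obtain ⟨m, hm⟩ := Finite.exists_min u
  refine le_trans ?_ (hm x)
  by_contra! hneg
  have hmA : m ∉ A := fun h => absurd (hA m h) (not_le.2 hneg)
  have h1 := G.neg_mul_le_gen_of_isMin hm
  have h2 := hu m hmA
  nlinarith [G.β_pos]

/-- Comparison principle. -/
lemma le_of_gen_le {u v : E → ℝ} {A : Set E} (hA : ∀ x ∈ A, u x ≤ v x)
    (hu : ∀ x, x ∉ A → G.gen v x ≤ G.gen u x) (x : E) : u x ≤ v x := by
  have := G.nonneg_of_gen_nonpos (u := v - u) (A := A) (fun x hx => sub_nonneg.2 (hA x hx))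
    (fun x hx => by rw [gen_sub]; linarith [hu x hx]) x
  exact sub_nonneg.1 this

/-- At a point where two ordered functions touch, their generators are ordered. -/
lemma gen_le_of_touch {u v : E → ℝ} (h : ∀ y, u y ≤ v y) {x : E} (hx : u x = v x) :
    G.gen u x ≤ G.gen v x := by
  have := G.neg_mul_le_gen_of_isMin (u := v - u) (x := x)
    (fun y => by simpa [hx] using h y)
  rw [gen_sub] at this
  simp only [Pi.sub_apply, hx, sub_self, mul_zero, neg_zero] at this
  linarith

-- Comparison gives uniqueness, that is, injectivity of a linear endomorphism of a
-- finite-dimensional space; surjectivity, hence existence, follows.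
open scoped Classical in
lemma exists_dirichlet (A : Set E) (g : E → ℝ) :
    ∃ u : E → ℝ, (∀ x ∈ A, u x = g x) ∧ ∀ x, x ∉ A → G.gen u x = 0 := by
  let T : (E → ℝ) →ₗ[ℝ] (E → ℝ) :=
    { toFun := fun u x => if x ∈ A then u x else G.gen u x
      map_add' := fun u v => by
        ext x
        by_cases hx : x ∈ A <;> simp [hx, gen_add]
      map_smul' := fun c u => by
        ext x
        by_cases hx : x ∈ A <;> simp [hx, gen_smul] }
  have hT : ∀ u x, T u x = if x ∈ A then u x else G.gen u x := fun _ _ => rfl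
  have hinj : Function.Injective T := by
    intro u v huv
    have h1 : ∀ x ∈ A, u x = v x := fun x hx => by
      have := congrFun huv x
      simpa [hT, hx] using this
    have h2 : ∀ x, x ∉ A → G.gen u x = G.gen v x := fun x hx => by
      have := congrFun huv x
      simpa [hT, hx] using this
    ext x
    exact le_antisymm (G.le_of_gen_le (fun x hx => (h1 x hx).le) (fun x hx => (h2 x hx).ge) x)
      (G.le_of_gen_le (fun x hx => (h1 x hx).ge) (fun x hx => (h2 x hx).le) x)
  obtain ⟨u, hu⟩ := LinearMap.injective_iff_surjective.1 hinj (fun x => if x ∈ A then g x else 0)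
  refine ⟨u, fun x hx => ?_, fun x hx => ?_⟩
  · simpa [hT, hx] using congrFun hu x
  · simpa [hT, hx] using congrFun hu x

/-! ### Hitting times -/

lemma hit_le_of_mem {A : Set E} {ω : Ω} {t : ℝ≥0} (h : G.X t ω ∈ A) : G.hit A ω ≤ t :=
  hittingAfter_le_of_mem zero_le h

lemma notMem_of_lt_hit {A : Set E} {ω : Ω} {t : ℝ≥0} (h : (t : WithTop ℝ≥0) < G.hit A ω) :
    G.X t ω ∉ A :=
  notMem_of_lt_hittingAfter h zero_le

/-- The infimum is attained by right-continuity: if X_t were outside A, the path would stay constant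
on some [t, u), and so could not enter A before u. -/
lemma mem_of_hit_eq {A : Set E} {ω : Ω} {t : ℝ≥0} (h : G.hit A ω = t) : G.X t ω ∈ A := by
  by_contra hA
  obtain ⟨u, hu, hcon⟩ : ∃ u > t, ∀ s ∈ Set.Ico t u, G.X s ω = G.X t ω := by
    have := G.rightCont ω t
    rw [eventually_iff, mem_nhdsGE_iff_exists_Ico_subset] at this
    obtain ⟨u, hu, hsub⟩ := this
    exact ⟨u, hu, fun s hs => hsub hs⟩
  have hlt : G.hit A ω < u := by
    rw [h]
    exact_mod_cast hu
  obtain ⟨j, hj, hjA⟩ := (hittingAfter_lt_iff (u := G.X) (s := A) (n := 0)).1 hlt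
  rcases le_or_gt t j with htj | htj
  · exact hA (hcon j ⟨htj, hj.2⟩ ▸ hjA)
  · have := G.hit_le_of_mem hjA
    rw [h] at this
    exact absurd (WithTop.coe_le_coe.1 this) (not_le.2 htj)

lemma hit_le_iff {A : Set E} {ω : Ω} {t : ℝ≥0} :
    G.hit A ω ≤ t ↔ ∃ s ≤ t, G.X s ω ∈ A := by
  constructor
  · intro h
    obtain ⟨s, hs⟩ := WithTop.ne_top_iff_exists.1 (ne_top_of_le_ne_top WithTop.coe_ne_top h)
    rw [← hs] at h
    exact ⟨s, WithTop.coe_le_coe.1 h, G.mem_of_hit_eq hs.symm⟩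
  · rintro ⟨s, hs, hA⟩
    exact (G.hit_le_of_mem hA).trans (WithTop.coe_le_coe.2 hs)

lemma hit_union (A B : Set E) (ω : Ω) : G.hit (A ∪ B) ω = min (G.hit A ω) (G.hit B ω) := by
  refine le_antisymm ?_ ?_
  · exact le_min (hittingAfter_apply_anti G.X 0 ω Set.subset_union_left)
      (hittingAfter_apply_anti G.X 0 ω Set.subset_union_right)
  · rcases eq_or_ne (G.hit (A ∪ B) ω) ⊤ with h | h
    · simp [h]
    · obtain ⟨t, ht⟩ := WithTop.ne_top_iff_exists.1 h
      rcases G.mem_of_hit_eq ht.symm with hA | hB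
      · exact (min_le_left _ _).trans (ht ▸ G.hit_le_of_mem hA)
      · exact (min_le_right _ _).trans (ht ▸ G.hit_le_of_mem hB)

lemma hit_empty (ω : Ω) : G.hit ∅ ω = ⊤ := by
  simp [hit]

lemma top_mem_stoppingTimes : (fun _ => ⊤ : Ω → WithTop ℝ≥0) ∈ G.stoppingTimes := by
  intro t
  simp

lemma measurable_X_filtration {s t : ℝ≥0} (hst : s ≤ t) : Measurable[G.filtration t] (G.X s) :=
  Measurable.mono (comap_measurable (G.X s))
    (le_iSup₂_of_le (f := fun r (_ : r ≤ t) => MeasurableSpace.comap (G.X r) inferInstance)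
      s hst le_rfl) le_rfl

variable [DiscreteMeasurableSpace E]

lemma measurableSet_X_mem {s t : ℝ≥0} (hst : s ≤ t) (A : Set E) :
    MeasurableSet[G.filtration t] {ω | G.X s ω ∈ A} :=
  G.measurable_X_filtration hst (MeasurableSet.of_discrete (s := A))

/-- A path that enters A at some s < t remains in that state for a while, so it is seen in A at a
rational time before t. The time t itself needs a separate term. -/
lemma hit_mem_stoppingTimes (A : Set E) : G.hit A ∈ G.stoppingTimes := by
  intro t
  have : {ω | G.hit A ω ≤ t} = {ω | G.X t ω ∈ A} ∪
      ⋃ q : ℚ, ⋃ _ : (q : ℝ).toNNReal ≤ t, {ω | G.X (q : ℝ).toNNReal ω ∈ A} := by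
    ext ω
    simp only [Set.mem_ofPred_eq, hit_le_iff, Set.mem_union, Set.mem_iUnion, exists_prop]
    constructor
    · rintro ⟨s, hs, hA⟩
      rcases hs.eq_or_lt with rfl | hs
      · exact Or.inl hA
      · right
        have h1 := G.rightCont ω s
        rw [eventually_iff, mem_nhdsGE_iff_exists_Ico_subset] at h1
        obtain ⟨u, hu, hsub⟩ := h1
        obtain ⟨q, hq1, hq2⟩ := exists_rat_btwn (NNReal.coe_lt_coe.2 (lt_min hu hs))
        have hsq : s ≤ (q : ℝ).toNNReal := NNReal.le_toNNReal_of_coe_le hq1.le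
        have hqm : (q : ℝ).toNNReal < min u t := by
          rw [Real.toNNReal_lt_iff_lt_coe (s.2.trans hq1.le)]
          exact hq2
        refine ⟨q, (hqm.trans_le (min_le_right _ _)).le, ?_⟩
        have := hsub ⟨hsq, hqm.trans_le (min_le_left _ _)⟩
        rw [Set.mem_ofPred_eq] at this
        rwa [this]
    · rintro (h | ⟨q, hq, hA⟩)
      · exact ⟨t, le_rfl, h⟩
      · exact ⟨_, hq, hA⟩
  rw [this]
  refine (G.measurableSet_X_mem le_rfl A).union ?_
  exact MeasurableSet.iUnion fun q => MeasurableSet.iUnion fun hq => G.measurableSet_X_mem hq A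

/-! ### The discounted process and Dynkin's inequality -/

instance isProbabilityMeasure_P (x : E) : IsProbabilityMeasure (G.P x) := G.isProb x

/-- The discounted process `exp (-β t) f (X_t)`. -/
def disc (f : E → ℝ) (t : ℝ≥0) (ω : Ω) : ℝ := Real.exp (-(G.β * t)) * f (G.X t ω)

/-- The discounted transition operator `exp (-β h) E_y[f (X_h)]`. -/
def discTrans (f : E → ℝ) (h : ℝ≥0) (y : E) : ℝ :=
  Real.exp (-(G.β * h)) * ∑ z, (G.P y).real {ω | G.X h ω = z} * f z

lemma abs_le_sum_abs (f : E → ℝ) (y : E) : |f y| ≤ ∑ z, |f z| :=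
  Finset.single_le_sum (f := fun z => |f z|) (fun _ _ => abs_nonneg _) (Finset.mem_univ y)

lemma abs_disc_le (f : E → ℝ) (t : ℝ≥0) (ω : Ω) : |G.disc f t ω| ≤ ∑ z, |f z| := by
  rw [disc, abs_mul, Real.abs_exp]
  refine (mul_le_of_le_one_left (abs_nonneg _) ?_).trans (abs_le_sum_abs f _)
  exact Real.exp_le_one_iff.2 (neg_nonpos.2 (mul_nonneg G.β_pos.le t.2))

lemma reward_coe {f : E → ℝ} {η : Ω → WithTop ℝ≥0} {ω : Ω} {t : ℝ≥0} (h : η ω = t) :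
    G.reward f η ω = G.disc f t ω := by
  simp only [reward, h, disc]

lemma reward_top {f : E → ℝ} {η : Ω → WithTop ℝ≥0} {ω : Ω} (h : η ω = ⊤) :
    G.reward f η ω = 0 := by
  simp only [reward, h]

lemma abs_reward_le (f : E → ℝ) (η : Ω → WithTop ℝ≥0) (ω : Ω) :
    |G.reward f η ω| ≤ ∑ z, |f z| := by
  rcases eq_or_ne (η ω) ⊤ with h | h
  · rw [G.reward_top h, abs_zero]
    exact Finset.sum_nonneg fun _ _ => abs_nonneg _
  · obtain ⟨t, ht⟩ := WithTop.ne_top_iff_exists.1 h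
    rw [G.reward_coe ht.symm]
    exact G.abs_disc_le f t ω

lemma reward_neg (f : E → ℝ) (η : Ω → WithTop ℝ≥0) (ω : Ω) :
    G.reward (-f) η ω = - G.reward f η ω := by
  rcases eq_or_ne (η ω) ⊤ with h | h
  · simp [G.reward_top h]
  · obtain ⟨t, ht⟩ := WithTop.ne_top_iff_exists.1 h
    simp [G.reward_coe ht.symm, disc]

lemma measurableSet_X_eq (t : ℝ≥0) (z : E) : MeasurableSet {ω | G.X t ω = z} :=
  G.measurable_X t (MeasurableSet.of_discrete (s := {z}))

lemma ae_start (x : E) : ∀ᵐ ω ∂(G.P x), G.X 0 ω = x :=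
  (prob_compl_eq_zero_iff (G.measurableSet_X_eq 0 x)).2 (G.start x)

open scoped Classical in
lemma measureReal_start (y z : E) :
    (G.P y).real {ω | G.X 0 ω = z} = if z = y then 1 else 0 := by
  split_ifs with hz
  · rw [hz, measureReal_def, G.start, ENNReal.toReal_one]
  · rw [measureReal_def, measure_eq_zero_iff_ae_notMem.2, ENNReal.toReal_zero]
    filter_upwards [G.ae_start y] with ω hω h
    exact hz (h.symm.trans hω)

lemma hasDerivWithinAt_discTrans (f : E → ℝ) (y : E) :
    HasDerivWithinAt (fun t : ℝ => Real.exp (-(G.β * t)) *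
      ∑ z, (G.P y).real {ω | G.X t.toNNReal ω = z} * f z) (G.gen f y) (Set.Ici 0) 0 := by
  classical
  have h1 : HasDerivWithinAt (fun t : ℝ => Real.exp (-(G.β * t))) (-G.β) (Set.Ici 0) 0 := by
    have : HasDerivAt (fun t : ℝ => Real.exp (-(G.β * t))) (Real.exp (-(G.β * 0)) * -(G.β * 1)) 0 :=
      (((hasDerivAt_id (0 : ℝ)).const_mul G.β).neg).exp
    simpa using this.hasDerivWithinAt
  have h2 : HasDerivWithinAt (fun t : ℝ => ∑ z, (G.P y).real {ω | G.X t.toNNReal ω = z} * f z)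
      (∑ z, G.Q y z * f z) (Set.Ici 0) 0 :=
    HasDerivWithinAt.fun_sum fun z _ => (G.generator y z).mul_const (f z)
  refine (h1.fun_mul h2).congr_deriv ?_
  simp [gen, measureReal_start]
  ring

/-- A right derivative at most 0 is below ε, so the slope is eventually below ε. Finiteness of `E`
makes this uniform in y. -/
lemma eventually_discTrans_le (f : E → ℝ) {ε : ℝ} (hε : 0 < ε) :
    ∀ᶠ t : ℝ in 𝓝[>] 0, ∀ y, G.gen f y ≤ 0 → G.discTrans f t.toNNReal y - f y ≤ ε * t := by
  rw [eventually_all]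
  intro y
  by_cases hy : G.gen f y ≤ 0
  swap
  · exact Eventually.of_forall fun t h => absurd h hy
  have hd := (G.hasDerivWithinAt_discTrans f y).Ioi_of_Ici
  rw [hasDerivWithinAt_iff_tendsto_slope' (by simp)] at hd
  have hval : G.discTrans f 0 y = f y := by
    classical
    simp [discTrans, measureReal_start]
  filter_upwards [hd.eventually_lt_const (hy.trans_lt hε), self_mem_nhdsWithin] with t ht htpos _
  have htpos : 0 < t := htpos
  rw [slope_def_field, sub_zero, div_lt_iff₀ htpos] at ht
  have e1 : G.discTrans f t.toNNReal y = Real.exp (-(G.β * t)) *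
      ∑ z, (G.P y).real {ω | G.X t.toNNReal ω = z} * f z := by
    rw [discTrans, Real.coe_toNNReal _ htpos.le]
  rw [discTrans] at hval
  rw [e1]
  simp only [Real.toNNReal_zero] at ht
  simp only [NNReal.coe_zero] at hval
  rw [hval] at ht
  exact ht.le

lemma measurable_disc (f : E → ℝ) (t : ℝ≥0) : Measurable (G.disc f t) :=
  ((measurable_of_finite f).comp (G.measurable_X t)).const_mul _

lemma integrable_disc (f : E → ℝ) (t : ℝ≥0) (x : E) : Integrable (G.disc f t) (G.P x) :=
  Integrable.of_bound (G.measurable_disc f t).aestronglyMeasurable (∑ z, |f z|)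
    (Eventually.of_forall fun ω => G.abs_disc_le f t ω)

lemma setIntegral_disc (f : E → ℝ) (t : ℝ≥0) (x : E) (A : Set Ω) :
    ∫ ω in A, G.disc f t ω ∂(G.P x) =
      Real.exp (-(G.β * t)) * ∑ z, (G.P x).real (A ∩ {ω | G.X t ω = z}) * f z := by
  classical
  have h : ∀ ω, G.disc f t ω = ∑ z, {ω | G.X t ω = z}.indicator
      (fun _ => Real.exp (-(G.β * t)) * f z) ω := by
    intro ω
    simp [Set.indicator_apply, disc]
  simp_rw [h]
  rw [integral_finsetSum _ fun z _ => (integrable_const _).indicator (G.measurableSet_X_eq t z),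
    Finset.mul_sum]
  refine Finset.sum_congr rfl fun z _ => ?_
  rw [integral_indicator_const _ (G.measurableSet_X_eq t z),
    measureReal_restrict_apply (G.measurableSet_X_eq t z), Set.inter_comm, smul_eq_mul]
  ring

lemma sum_measureReal_inter (x : E) (t : ℝ≥0) (B : Set Ω) :
    ∑ y, (G.P x).real (B ∩ {ω | G.X t ω = y}) = (G.P x).real B := by
  have := G.setIntegral_disc (fun _ => 1) t x B
  simp only [disc, mul_one, integral_const, smul_eq_mul, measureReal_restrict_apply,
    MeasurableSet.univ, Set.univ_inter] at this
  rw [mul_comm] at this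
  exact (mul_left_cancel₀ (Real.exp_pos _).ne' this).symm

/-- The Markov property at time s, after splitting A by the value of X_s. -/
lemma setIntegral_disc_add (f : E → ℝ) (s h : ℝ≥0) (x : E) {A : Set Ω}
    (hA : MeasurableSet[G.filtration s] A) :
    ∫ ω in A, G.disc f (s + h) ω ∂(G.P x) = Real.exp (-(G.β * s)) *
      ∑ y, (G.P x).real (A ∩ {ω | G.X s ω = y}) * G.discTrans f h y := by
  have hm : ∀ z, (G.P x).real (A ∩ {ω | G.X (s + h) ω = z}) =
      ∑ y, (G.P x).real (A ∩ {ω | G.X s ω = y}) * (G.P y).real {ω | G.X h ω = z} := by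
    intro z
    rw [← G.sum_measureReal_inter x s]
    refine Finset.sum_congr rfl fun y _ => ?_
    rw [Set.inter_right_comm, measureReal_def, G.markov x y z s h A hA, ENNReal.toReal_mul]
    rfl
  rw [setIntegral_disc]
  simp only [hm, discTrans, NNReal.coe_add, mul_add, neg_add, Real.exp_add, Finset.mul_sum,
    Finset.sum_mul]
  rw [Finset.sum_comm]
  exact Finset.sum_congr rfl fun y _ => Finset.sum_congr rfl fun z _ => by ring

/-- One-step supermartingale estimate. The factor exp(-βs) is kept because it makes the accumulated
errors summable over an infinite horizon. -/
lemma setIntegral_disc_sub_le (f : E → ℝ) (s h : ℝ≥0) (x : E) {A : Set Ω} {ε : ℝ} (hε : 0 ≤ ε)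
    (hA : MeasurableSet[G.filtration s] A) (hf : ∀ ω ∈ A, G.gen f (G.X s ω) ≤ 0)
    (hh : ∀ y, G.gen f y ≤ 0 → G.discTrans f h y - f y ≤ ε) :
    ∫ ω in A, (G.disc f (s + h) ω - G.disc f s ω) ∂(G.P x) ≤ Real.exp (-(G.β * s)) * ε := by
  rw [integral_sub (G.integrable_disc f _ x).integrableOn (G.integrable_disc f _ x).integrableOn,
    G.setIntegral_disc_add f s h x hA, setIntegral_disc, ← mul_sub, ← Finset.sum_sub_distrib]
  refine mul_le_mul_of_nonneg_left ?_ (Real.exp_pos _).le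
  calc _ ≤ ∑ y, (G.P x).real (A ∩ {ω | G.X s ω = y}) * ε := by
        refine Finset.sum_le_sum fun y _ => ?_
        rw [← mul_sub]
        rcases Set.eq_empty_or_nonempty (A ∩ {ω | G.X s ω = y}) with he | ⟨ω, hω, hy⟩
        · simp [he]
        · exact mul_le_mul_of_nonneg_left (hh y (hy ▸ hf ω hω)) measureReal_nonneg
    _ = (G.P x).real A * ε := by rw [← Finset.sum_mul, sum_measureReal_inter]
    _ ≤ ε := mul_le_of_le_one_left hε measureReal_le_one

lemma lt_mem_filtration {η : Ω → WithTop ℝ≥0} (hη : η ∈ G.stoppingTimes) (s : ℝ≥0) :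
    MeasurableSet[G.filtration s] {ω | (s : WithTop ℝ≥0) < η ω} :=
  IsStoppingTime.measurableSet_gt hη s

/-- The discounted process sampled along the grid of mesh `h`, for at most `N` steps, and stopped at
the first grid time after `η`. -/
def gridStop (f : E → ℝ) (η : Ω → WithTop ℝ≥0) (h : ℝ≥0) (N : ℕ) (ω : Ω) : ℝ :=
  G.disc f 0 ω + ∑ k ∈ Finset.range N, {ω | ((k * h : ℝ≥0) : WithTop ℝ≥0) < η ω}.indicator
    (fun ω => G.disc f (k * h + h) ω - G.disc f (k * h) ω) ω

lemma measurable_gridStop (f : E → ℝ) {η : Ω → WithTop ℝ≥0} (hη : η ∈ G.stoppingTimes)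
    (h : ℝ≥0) (N : ℕ) : Measurable (G.gridStop f η h N) := by
  refine (G.measurable_disc f 0).add (Finset.measurable_fun_sum _ fun k _ => ?_)
  exact ((G.measurable_disc f _).sub (G.measurable_disc f _)).indicator
    (G.filtration.le _ _ (G.lt_mem_filtration hη _))

lemma integral_disc_zero (f : E → ℝ) (x : E) : ∫ ω, G.disc f 0 ω ∂(G.P x) = f x := by
  have : ∀ᵐ ω ∂(G.P x), G.disc f 0 ω = f x := by
    filter_upwards [G.ae_start x] with ω hω
    simp [disc, hω]
  rw [integral_congr_ae this]
  simp

/-- A geometric sum with ratio r = exp(-bh). From 1 + bh ≤ exp(bh) one gets bh ≤ (1 - r)(1 + bh).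
The bound does not depend on N. -/
lemma sum_exp_mul_le (b : ℝ) (hb : 0 < b) (h : ℝ) (hh : 0 < h) (N : ℕ) :
    ∑ k ∈ Finset.range N, Real.exp (-(b * (k * h))) * h ≤ (1 + b * h) / b := by
  have hbh : 0 < b * h := mul_pos hb hh
  have e : ∀ k : ℕ, Real.exp (-(b * (k * h))) = Real.exp (-(b * h)) ^ k := fun k => by
    rw [← Real.exp_nat_mul]
    congr 1
    ring
  simp_rw [e]
  rw [← Finset.sum_mul]
  set r := Real.exp (-(b * h)) with hr
  have hr0 : 0 < r := Real.exp_pos _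
  have hr1 : r * (1 + b * h) ≤ 1 := by
    have := Real.add_one_le_exp (b * h)
    have h2 : r * Real.exp (b * h) = 1 := by rw [hr, ← Real.exp_add]; simp
    nlinarith
  have hS := geom_sum_mul_neg r N
  have hS0 : 0 ≤ ∑ i ∈ Finset.range N, r ^ i := Finset.sum_nonneg fun i _ => by positivity
  set S := ∑ i ∈ Finset.range N, r ^ i
  have hS1 : S * (1 - r) ≤ 1 := by rw [hS]; linarith [pow_pos hr0 N]
  rw [le_div_iff₀ hb]
  have h3 : b * h ≤ (1 - r) * (1 + b * h) := by nlinarith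
  calc S * h * b = S * (b * h) := by ring
    _ ≤ S * ((1 - r) * (1 + b * h)) := mul_le_mul_of_nonneg_left h3 hS0
    _ = (S * (1 - r)) * (1 + b * h) := by ring
    _ ≤ 1 * (1 + b * h) := mul_le_mul_of_nonneg_right hS1 (by positivity)
    _ = 1 + b * h := one_mul _

lemma integral_gridStop_le (f : E → ℝ) {η : Ω → WithTop ℝ≥0} (hη : η ∈ G.stoppingTimes)
    (hf : ∀ ω (s : ℝ≥0), s < η ω → G.gen f (G.X s ω) ≤ 0) {h : ℝ≥0} (hpos : 0 < h) {ε : ℝ}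
    (hε : 0 ≤ ε) (hh : ∀ y, G.gen f y ≤ 0 → G.discTrans f h y - f y ≤ ε * h) (N : ℕ) (x : E) :
    ∫ ω, G.gridStop f η h N ω ∂(G.P x) ≤ f x + ε * ((1 + G.β * h) / G.β) := by
  have hms : ∀ k : ℕ, MeasurableSet {ω | ((k * h : ℝ≥0) : WithTop ℝ≥0) < η ω} := fun k =>
    G.filtration.le _ _ (G.lt_mem_filtration hη _)
  have hint : ∀ k : ℕ, Integrable ({ω | ((k * h : ℝ≥0) : WithTop ℝ≥0) < η ω}.indicator
    (fun ω => G.disc f (k * h + h) ω - G.disc f (k * h) ω)) (G.P x) := fun k =>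
    ((G.integrable_disc f _ x).sub (G.integrable_disc f _ x)).indicator (hms k)
  simp only [gridStop]
  rw [integral_add (G.integrable_disc f 0 x) (integrable_finsetSum _ fun k _ => hint k),
    integral_finsetSum _ fun k _ => hint k, integral_disc_zero]
  gcongr
  calc _ ≤ ∑ k ∈ Finset.range N, Real.exp (-(G.β * (k * h))) * (ε * h) := by
        refine Finset.sum_le_sum fun k _ => ?_
        rw [integral_indicator (hms k)]
        have := G.setIntegral_disc_sub_le f (k * h) h x (by positivity)
          (G.lt_mem_filtration hη (k * h)) (fun ω hω => hf ω _ hω) hh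
        simpa using this
    _ = ε * ∑ k ∈ Finset.range N, Real.exp (-(G.β * (k * h))) * h := by
        rw [Finset.mul_sum]
        exact Finset.sum_congr rfl fun k _ => by ring
    _ ≤ _ := mul_le_mul_of_nonneg_left (sum_exp_mul_le _ G.β_pos _ hpos N) hε

open scoped Classical in
lemma telescope_min (m : ℕ → ℝ) (j N : ℕ) :
    m 0 + ∑ k ∈ Finset.range N, (if k < j then m (k + 1) - m k else 0) = m (min j N) := by
  induction N with
  | zero => simp
  | succ N ih =>
    rw [Finset.sum_range_succ, ← add_assoc, ih]
    by_cases h : N < j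
    · rw [if_pos h, min_eq_right h.le, min_eq_right h]
      ring
    · rw [if_neg h, min_eq_left (not_lt.1 h), min_eq_left ((not_lt.1 h).trans N.le_succ), add_zero]

/-- The condition kh < t means k < ⌈t/h⌉, so the sum telescopes up to the first grid time at or
after t, capped at N steps. -/
lemma gridStop_coe (f : E → ℝ) {η : Ω → WithTop ℝ≥0} {h : ℝ≥0} (hpos : 0 < h) (N : ℕ) {ω : Ω}
    {t : ℝ≥0} (ht : η ω = t) :
    G.gridStop f η h N ω = G.disc f ((min ⌈t / h⌉₊ N : ℕ) * h) ω := by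
  classical
  have := telescope_min (fun k => G.disc f (k * h) ω) ⌈t / h⌉₊ N
  rw [← this, gridStop]
  simp only [Nat.cast_zero, zero_mul, Set.indicator_apply, Set.mem_ofPred_eq, ht,
    WithTop.coe_lt_coe, Nat.lt_ceil, lt_div_iff₀ hpos, Nat.cast_add, Nat.cast_one, add_mul,
    one_mul]

lemma gridStop_top (f : E → ℝ) {η : Ω → WithTop ℝ≥0} (h : ℝ≥0) (N : ℕ) {ω : Ω} (ht : η ω = ⊤) :
    G.gridStop f η h N ω = G.disc f (N * h) ω := by
  classical
  have := telescope_min (fun k => G.disc f (k * h) ω) N N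
  rw [min_self] at this
  rw [← this, gridStop]
  congr 1
  · simp
  · refine Finset.sum_congr rfl fun k hk => ?_
    rw [if_pos (Finset.mem_range.1 hk), Set.indicator_of_mem]
    · simp [add_mul]
    · rw [Set.mem_ofPred_eq, ht]
      exact WithTop.coe_lt_top _

lemma abs_gridStop_le (f : E → ℝ) (η : Ω → WithTop ℝ≥0) {h : ℝ≥0} (hpos : 0 < h) (N : ℕ) (ω : Ω) :
    |G.gridStop f η h N ω| ≤ ∑ z, |f z| := by
  rcases eq_or_ne (η ω) ⊤ with ht | ht
  · rw [G.gridStop_top f h N ht]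
    exact G.abs_disc_le f _ ω
  · obtain ⟨t, ht⟩ := WithTop.ne_top_iff_exists.1 ht
    rw [G.gridStop_coe f hpos N ht.symm]
    exact G.abs_disc_le f _ ω

/-- The mesh of the grids used to approximate a stopping time from the right. -/
def mesh (n : ℕ) : ℝ≥0 := ((n : ℝ≥0) + 1)⁻¹

lemma mesh_pos (n : ℕ) : 0 < mesh n := by
  unfold mesh
  positivity

lemma tendsto_mesh : Tendsto (fun n => (mesh n : ℝ)) atTop (𝓝 0) := by
  simpa [mesh] using tendsto_one_div_add_atTop_nhds_zero_nat (𝕜 := ℝ)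

lemma tendsto_disc_zero (f : E → ℝ) {u : ℕ → ℝ≥0} (hu : Tendsto (fun n => (u n : ℝ)) atTop atTop)
    (ω : Ω) : Tendsto (fun n => G.disc f (u n) ω) atTop (𝓝 0) := by
  have h1 : Tendsto (fun n => Real.exp (-(G.β * u n)) * ∑ z, |f z|) atTop (𝓝 (0 * ∑ z, |f z|)) :=
    (Real.tendsto_exp_neg_atTop_nhds_zero.comp (hu.const_mul_atTop G.β_pos)).mul_const _
  rw [zero_mul] at h1
  refine squeeze_zero_norm (fun n => ?_) h1
  rw [disc, Real.norm_eq_abs, abs_mul, Real.abs_exp]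
  exact mul_le_mul_of_nonneg_left (abs_le_sum_abs f _) (Real.exp_pos _).le

lemma tendsto_disc_right (f : E → ℝ) {u : ℕ → ℝ≥0} {t : ℝ≥0} (hu : Tendsto u atTop (𝓝[≥] t))
    (ω : Ω) : Tendsto (fun n => G.disc f (u n) ω) atTop (𝓝 (G.disc f t ω)) := by
  have h1 : Tendsto (fun n => Real.exp (-(G.β * u n))) atTop (𝓝 (Real.exp (-(G.β * t)))) := by
    have hc : Continuous fun s : ℝ≥0 => Real.exp (-(G.β * s)) := by fun_prop
    exact (hc.tendsto t).comp (hu.mono_right nhdsWithin_le_nhds)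
  have h2 : Tendsto (fun n => f (G.X (u n) ω)) atTop (𝓝 (f (G.X t ω))) := by
    refine tendsto_const_nhds.congr' ?_
    filter_upwards [hu.eventually (G.rightCont ω t)] with n hn
    rw [hn]
  exact h1.mul h2

/-- With mesh 1/(n+1), taking (n+1)² steps gives the horizon n+1, which tends to infinity. If η is
finite, grid times approach it from the right and right-continuity suffices; if η = ∞, discounting
sends the sampled value to 0. -/
lemma tendsto_gridStop (f : E → ℝ) (η : Ω → WithTop ℝ≥0) (ω : Ω) :
    Tendsto (fun n => G.gridStop f η (mesh n) ((n + 1) ^ 2) ω) atTop (𝓝 (G.reward f η ω)) := by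
  rcases eq_or_ne (η ω) ⊤ with ht | ht
  · rw [G.reward_top ht]
    simp only [G.gridStop_top f _ _ ht]
    refine G.tendsto_disc_zero f ?_ ω
    have : (fun n : ℕ => (((((n + 1) ^ 2 : ℕ) : ℝ≥0) * mesh n : ℝ≥0) : ℝ)) =
        fun n : ℕ => (n : ℝ) + 1 := by
      ext n
      have : (n : ℝ) + 1 ≠ 0 := by positivity
      push_cast [mesh]
      field_simp
    rw [this]
    exact tendsto_atTop_add_const_right _ _ tendsto_natCast_atTop_atTop
  · obtain ⟨t, ht⟩ := WithTop.ne_top_iff_exists.1 ht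
    rw [G.reward_coe ht.symm]
    simp only [G.gridStop_coe f (mesh_pos _) _ ht.symm]
    -- The cap on the number of steps is inactive once n ≥ t, since then t(n+1) ≤ (n+1)².
    have hmin : ∀ᶠ n : ℕ in atTop,
        (⌈t / mesh n⌉₊ : ℝ≥0) * mesh n = (min ⌈t / mesh n⌉₊ ((n + 1) ^ 2) : ℕ) * mesh n := by
      filter_upwards [eventually_ge_atTop ⌈t⌉₊] with n hn
      rw [min_eq_left]
      refine Nat.ceil_le.2 ?_
      have htn : t ≤ (n : ℝ≥0) + 1 := (Nat.ceil_le.1 hn).trans (by simp)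
      rw [mesh, div_inv_eq_mul]
      push_cast
      rw [sq]
      gcongr
    have hlow : ∀ n, t ≤ (⌈t / mesh n⌉₊ : ℝ≥0) * mesh n := fun n =>
      (div_le_iff₀ (mesh_pos n)).1 (Nat.le_ceil _)
    have hup : ∀ n, (⌈t / mesh n⌉₊ : ℝ≥0) * mesh n ≤ t + mesh n := fun n => by
      have h := (Nat.ceil_lt_add_one (a := t / mesh n) zero_le).le
      calc _ ≤ (t / mesh n + 1) * mesh n := by gcongr
        _ = t + mesh n := by rw [add_mul, div_mul_cancel₀ _ (mesh_pos n).ne', one_mul]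
    have hmesh : Tendsto mesh atTop (𝓝 0) := NNReal.tendsto_coe.1 (by simpa using tendsto_mesh)
    refine G.tendsto_disc_right f (tendsto_nhdsWithin_iff.2 ⟨?_, ?_⟩) ω
    · refine Tendsto.congr' hmin ?_
      refine tendsto_of_tendsto_of_tendsto_of_le_of_le tendsto_const_nhds ?_ hlow hup
      simpa using hmesh.const_add t
    · filter_upwards [hmin] with n hn
      rw [← hn]
      exact hlow n

lemma measurable_reward (f : E → ℝ) {η : Ω → WithTop ℝ≥0} (hη : η ∈ G.stoppingTimes) :
    Measurable (G.reward f η) :=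
  measurable_of_tendsto_metrizable (fun n => G.measurable_gridStop f hη (mesh n) ((n + 1) ^ 2))
    (tendsto_pi_nhds.2 fun ω => G.tendsto_gridStop f η ω)

lemma integrable_reward (f : E → ℝ) {η : Ω → WithTop ℝ≥0} (hη : η ∈ G.stoppingTimes) (x : E) :
    Integrable (G.reward f η) (G.P x) :=
  Integrable.of_bound (G.measurable_reward f hη).aestronglyMeasurable (∑ z, |f z|)
    (Eventually.of_forall fun ω => G.abs_reward_le f η ω)

/-- Dynkin's inequality for a function that is superharmonic along the path until `η`. -/
lemma integral_reward_le {f : E → ℝ} {η : Ω → WithTop ℝ≥0} (hη : η ∈ G.stoppingTimes)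
    (hf : ∀ ω (s : ℝ≥0), s < η ω → G.gen f (G.X s ω) ≤ 0) (x : E) :
    ∫ ω, G.reward f η ω ∂(G.P x) ≤ f x := by
  have hlim : Tendsto (fun n => ∫ ω, G.gridStop f η (mesh n) ((n + 1) ^ 2) ω ∂(G.P x)) atTop
      (𝓝 (∫ ω, G.reward f η ω ∂(G.P x))) :=
    tendsto_integral_of_dominated_convergence (fun _ => ∑ z, |f z|)
      (fun n => (G.measurable_gridStop f hη _ _).aestronglyMeasurable) (integrable_const _)
      (fun n => Eventually.of_forall fun ω => G.abs_gridStop_le f η (mesh_pos n) _ ω)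
      (Eventually.of_forall fun ω => G.tendsto_gridStop f η ω)
  refine le_of_forall_pos_le_add fun δ hδ => ?_
  have hβ := G.β_pos
  -- Chosen so that the total grid error is at most ε(1 + β)/β = δ, using that the mesh is at most
  -- 1.
  set ε := δ * (G.β / (1 + G.β)) with hεdef
  have hε : 0 < ε := by positivity
  have hev : ∀ᶠ n in atTop, ∀ y, G.gen f y ≤ 0 →
      G.discTrans f (mesh n) y - f y ≤ ε * mesh n := by
    have hm : Tendsto (fun n => (mesh n : ℝ)) atTop (𝓝[>] 0) :=
      tendsto_nhdsWithin_iff.2 ⟨tendsto_mesh, Eventually.of_forall fun n =>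
        NNReal.coe_pos.2 (mesh_pos n)⟩
    simpa using hm.eventually (G.eventually_discTrans_le f hε)
  refine le_of_tendsto hlim ?_
  filter_upwards [hev] with n hn
  refine (G.integral_gridStop_le f hη hf (mesh_pos n) hε.le hn _ x).trans ?_
  have hm1 : (mesh n : ℝ) ≤ 1 := by
    rw [mesh]
    push_cast
    exact inv_le_one_of_one_le₀ (by linarith [(Nat.cast_nonneg n : (0 : ℝ) ≤ n)])
  have : (1 + G.β * mesh n) / G.β ≤ (1 + G.β) / G.β := by
    gcongr
    exact mul_le_of_le_one_right hβ.le hm1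
  have h2 := mul_le_mul_of_nonneg_left this hε.le
  have h3 : ε * ((1 + G.β) / G.β) = δ := by
    rw [hεdef]
    field_simp
  linarith

lemma le_integral_reward {f : E → ℝ} {η : Ω → WithTop ℝ≥0} (hη : η ∈ G.stoppingTimes)
    (hf : ∀ ω (s : ℝ≥0), s < η ω → 0 ≤ G.gen f (G.X s ω)) (x : E) :
    f x ≤ ∫ ω, G.reward f η ω ∂(G.P x) := by
  have := G.integral_reward_le (f := -f) hη
    (fun ω s hs => by rw [gen_neg]; exact neg_nonpos.2 (hf ω s hs)) x
  simp only [reward_neg, integral_neg, Pi.neg_apply] at this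
  linarith

/-! ### The expected payoff -/

open scoped Classical in
/-- The random payoff whose expectation is `payoff`. -/
def payoffFun (τ γ : Ω → WithTop ℝ≥0) (ω : Ω) : ℝ :=
  if τ ω ≤ γ ω then G.reward G.ψ τ ω else G.reward G.φ γ ω

lemma payoff_eq_integral (τ γ : Ω → WithTop ℝ≥0) (x : E) :
    G.payoff τ γ x = ∫ ω, G.payoffFun τ γ ω ∂(G.P x) := rfl

/-- A common bound for all payoffs. -/
def payoffBound : ℝ := ∑ z, |G.ψ z| + ∑ z, |G.φ z|

lemma abs_payoffFun_le (τ γ : Ω → WithTop ℝ≥0) (ω : Ω) :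
    |G.payoffFun τ γ ω| ≤ G.payoffBound := by
  have h1 : 0 ≤ ∑ z, |G.ψ z| := Finset.sum_nonneg fun _ _ => abs_nonneg _
  have h2 : 0 ≤ ∑ z, |G.φ z| := Finset.sum_nonneg fun _ _ => abs_nonneg _
  rw [payoffFun, payoffBound]
  split_ifs
  · linarith [G.abs_reward_le G.ψ τ ω]
  · linarith [G.abs_reward_le G.φ γ ω]

lemma abs_payoff_le (τ γ : Ω → WithTop ℝ≥0) (x : E) : |G.payoff τ γ x| ≤ G.payoffBound := by
  rw [payoff_eq_integral]
  have := norm_integral_le_of_norm_le_const (μ := G.P x) (f := G.payoffFun τ γ)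
    (Eventually.of_forall fun ω => G.abs_payoffFun_le τ γ ω)
  simpa using this

lemma integrable_payoffFun {τ γ : Ω → WithTop ℝ≥0} (hτ : τ ∈ G.stoppingTimes)
    (hγ : γ ∈ G.stoppingTimes) (x : E) : Integrable (G.payoffFun τ γ) (G.P x) := by
  have hle : MeasurableSet {ω | τ ω ≤ γ ω} :=
    IsStoppingTime.measurableSpace_le hτ _
      (IsStoppingTime.measurableSet_le_stopping_time hτ hγ)
  refine Integrable.of_bound (Measurable.ite hle (G.measurable_reward _ hτ)
    (G.measurable_reward _ hγ)).aestronglyMeasurable G.payoffBound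
    (Eventually.of_forall fun ω => G.abs_payoffFun_le τ γ ω)

lemma min_mem_stoppingTimes {τ γ : Ω → WithTop ℝ≥0} (hτ : τ ∈ G.stoppingTimes)
    (hγ : γ ∈ G.stoppingTimes) : (fun ω => min (τ ω) (γ ω)) ∈ G.stoppingTimes :=
  IsStoppingTime.min hτ hγ

lemma reward_congr {f : E → ℝ} {η η' : Ω → WithTop ℝ≥0} {ω : Ω} (h : η ω = η' ω) :
    G.reward f η ω = G.reward f η' ω := by
  simp only [reward, h]

lemma reward_le_reward {f g : E → ℝ} {η : Ω → WithTop ℝ≥0} {ω : Ω}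
    (h : ∀ t : ℝ≥0, η ω = t → f (G.X t ω) ≤ g (G.X t ω)) :
    G.reward f η ω ≤ G.reward g η ω := by
  rcases eq_or_ne (η ω) ⊤ with ht | ht
  · simp [G.reward_top ht]
  · obtain ⟨t, ht⟩ := WithTop.ne_top_iff_exists.1 ht
    rw [G.reward_coe ht.symm, G.reward_coe ht.symm]
    exact mul_le_mul_of_nonneg_left (h t ht.symm) (Real.exp_pos _).le

/-- Verification: a function which is superharmonic until one of the players stops and which
dominates the terminal payoffs dominates the expected payoff. -/
lemma payoff_le {V : E → ℝ} {τ γ : Ω → WithTop ℝ≥0} (hτ : τ ∈ G.stoppingTimes)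
    (hγ : γ ∈ G.stoppingTimes)
    (hV : ∀ ω (s : ℝ≥0), s < τ ω → s < γ ω → G.gen V (G.X s ω) ≤ 0)
    (hψ : ∀ ω (t : ℝ≥0), τ ω = t → t ≤ γ ω → G.ψ (G.X t ω) ≤ V (G.X t ω))
    (hφ : ∀ ω (t : ℝ≥0), γ ω = t → t < τ ω → G.φ (G.X t ω) ≤ V (G.X t ω)) (x : E) :
    G.payoff τ γ x ≤ V x := by
  have hη := G.min_mem_stoppingTimes hτ hγ
  refine le_trans ?_ (G.integral_reward_le (f := V) hη
    (fun ω s hs => hV ω s (lt_min_iff.1 hs).1 (lt_min_iff.1 hs).2) x)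
  rw [payoff_eq_integral]
  refine integral_mono (G.integrable_payoffFun hτ hγ x) (G.integrable_reward V hη x) fun ω => ?_
  rw [payoffFun]
  split_ifs with h
  · rw [G.reward_congr (η := fun ω => min (τ ω) (γ ω)) (η' := τ) (min_eq_left h)]
    exact G.reward_le_reward fun t ht => hψ ω t ht (ht ▸ h)
  · rw [not_le] at h
    rw [G.reward_congr (η := fun ω => min (τ ω) (γ ω)) (η' := γ) (min_eq_right h.le)]
    exact G.reward_le_reward fun t ht => hφ ω t ht (ht ▸ h)

/-- The subharmonic counterpart of `payoff_le`. In both, the weak inequality t ≤ γ in the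
ψ-condition and the strict t < τ in the φ-condition reflect that a simultaneous stop pays ψ. -/
lemma le_payoff {V : E → ℝ} {τ γ : Ω → WithTop ℝ≥0} (hτ : τ ∈ G.stoppingTimes)
    (hγ : γ ∈ G.stoppingTimes)
    (hV : ∀ ω (s : ℝ≥0), s < τ ω → s < γ ω → 0 ≤ G.gen V (G.X s ω))
    (hψ : ∀ ω (t : ℝ≥0), τ ω = t → t ≤ γ ω → V (G.X t ω) ≤ G.ψ (G.X t ω))
    (hφ : ∀ ω (t : ℝ≥0), γ ω = t → t < τ ω → V (G.X t ω) ≤ G.φ (G.X t ω)) (x : E) :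
    V x ≤ G.payoff τ γ x := by
  have hη := G.min_mem_stoppingTimes hτ hγ
  refine le_trans (G.le_integral_reward (f := V) hη
    (fun ω s hs => hV ω s (lt_min_iff.1 hs).1 (lt_min_iff.1 hs).2) x) ?_
  rw [payoff_eq_integral]
  refine integral_mono (G.integrable_reward V hη x) (G.integrable_payoffFun hτ hγ x) fun ω => ?_
  rw [payoffFun]
  split_ifs with h
  · rw [G.reward_congr (η := fun ω => min (τ ω) (γ ω)) (η' := τ) (min_eq_left h)]
    exact G.reward_le_reward fun t ht => hψ ω t ht (ht ▸ h)
  · rw [not_le] at h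
    rw [G.reward_congr (η := fun ω => min (τ ω) (γ ω)) (η' := γ) (min_eq_right h.le)]
    exact G.reward_le_reward fun t ht => hφ ω t ht (ht ▸ h)

/-- The expected payoff for two hitting times solves a Dirichlet problem. -/
lemma payoff_hit_eq {D S : Set E} {u : E → ℝ} (hD : ∀ x ∈ D, u x = G.ψ x)
    (hS : ∀ x ∈ S, u x = G.φ x) (hu : ∀ x, x ∉ D ∪ S → G.gen u x = 0) (x : E) :
    G.payoff (G.hit D) (G.hit S) x = u x := by
  have hgen : ∀ ω (s : ℝ≥0), s < G.hit D ω → s < G.hit S ω → G.gen u (G.X s ω) = 0 :=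
    fun ω s h1 h2 => hu _ fun h => h.elim (G.notMem_of_lt_hit h1) (G.notMem_of_lt_hit h2)
  refine le_antisymm
    (G.payoff_le (G.hit_mem_stoppingTimes D) (G.hit_mem_stoppingTimes S) ?_ ?_ ?_ x)
    (G.le_payoff (G.hit_mem_stoppingTimes D) (G.hit_mem_stoppingTimes S) ?_ ?_ ?_ x)
  · exact fun ω s h1 h2 => (hgen ω s h1 h2).le
  · exact fun ω t ht _ => (hD _ (G.mem_of_hit_eq ht)).ge
  · exact fun ω t ht _ => (hS _ (G.mem_of_hit_eq ht)).ge
  · exact fun ω s h1 h2 => (hgen ω s h1 h2).ge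
  · exact fun ω t ht _ => (hD _ (G.mem_of_hit_eq ht)).le
  · exact fun ω t ht _ => (hS _ (G.mem_of_hit_eq ht)).le

/-- Disjointness makes the boundary data, ψ on D and φ on S, consistent; the Dirichlet solution with
these data is then the payoff. -/
lemma payoff_hit_spec {D S : Set E} (hDS : Disjoint D S) :
    (∀ x ∈ D, G.payoff (G.hit D) (G.hit S) x = G.ψ x) ∧
    (∀ x ∈ S, G.payoff (G.hit D) (G.hit S) x = G.φ x) ∧
    ∀ x, x ∉ D ∪ S → G.gen (G.payoff (G.hit D) (G.hit S)) x = 0 := by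
  classical
  obtain ⟨u, hu, hgen⟩ := G.exists_dirichlet (D ∪ S) (fun x => if x ∈ D then G.ψ x else G.φ x)
  have hD : ∀ x ∈ D, u x = G.ψ x := fun x hx => by simp [hu x (Or.inl hx), hx]
  have hS : ∀ x ∈ S, u x = G.φ x := fun x hx => by
    simp [hu x (Or.inr hx), hDS.notMem_of_mem_right hx]
  have : G.payoff (G.hit D) (G.hit S) = u := funext (G.payoff_hit_eq hD hS hgen)
  rw [this]
  exact ⟨hD, hS, hgen⟩

instance nonempty_stoppingTimes : Nonempty G.stoppingTimes := ⟨⟨_, G.top_mem_stoppingTimes⟩⟩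

/-- Real suprema and infima of unbounded families take a default value, so bounds over all stopping
times are needed before they can be used. -/
lemma bddAbove_payoff (γ : Ω → WithTop ℝ≥0) (x : E) :
    BddAbove (Set.range fun τ : G.stoppingTimes => G.payoff τ γ x) := by
  refine ⟨G.payoffBound, ?_⟩
  rintro _ ⟨τ, rfl⟩
  exact (abs_le.1 (G.abs_payoff_le τ γ x)).2

lemma bddBelow_payoff (τ : Ω → WithTop ℝ≥0) (x : E) :
    BddBelow (Set.range fun γ : G.stoppingTimes => G.payoff τ γ x) := by
  refine ⟨-G.payoffBound, ?_⟩
  rintro _ ⟨γ, rfl⟩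
  exact (abs_le.1 (G.abs_payoff_le τ γ x)).1

lemma payoff_le_bestReply (S : Set E) {τ : Ω → WithTop ℝ≥0} (hτ : τ ∈ G.stoppingTimes) (x : E) :
    G.payoff τ (G.hit S) x ≤ G.bestReply S x :=
  le_ciSup (G.bddAbove_payoff (G.hit S) x) ⟨τ, hτ⟩

/-- The empty set is never hit, so V₀ is the best reply to an opponent who never stops, and results
on best replies apply to it. -/
lemma onePlayerValue_eq : G.onePlayerValue = G.bestReply ∅ := by
  have h : G.hit ∅ = fun _ => ⊤ := funext fun ω => G.hit_empty ω
  ext x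
  simp only [onePlayerValue, bestReply, payoff, h, le_top, if_true]

lemma bestReply_le {S : Set E} {V : E → ℝ} (hψ : ∀ x, G.ψ x ≤ V x) (hφ : ∀ x ∈ S, G.φ x ≤ V x)
    (hV : ∀ x, x ∉ S → G.gen V x ≤ 0) (x : E) : G.bestReply S x ≤ V x :=
  ciSup_le fun τ => G.payoff_le τ.2 (G.hit_mem_stoppingTimes S)
    (fun _ _ _ hs => hV _ (G.notMem_of_lt_hit hs)) (fun _ _ _ _ => hψ _)
    (fun _ _ ht _ => hφ _ (G.mem_of_hit_eq ht)) x

/-- A saddle point whose payoff is `W` yields a Nash equilibrium with value `W`. -/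
lemma isNash_and_isValue {W : E → ℝ} {τ' γ' : Ω → WithTop ℝ≥0} (hτ' : τ' ∈ G.stoppingTimes)
    (hγ' : γ' ∈ G.stoppingTimes) (h1 : ∀ τ ∈ G.stoppingTimes, ∀ x, G.payoff τ γ' x ≤ W x)
    (h2 : ∀ γ ∈ G.stoppingTimes, ∀ x, W x ≤ G.payoff τ' γ x) :
    G.IsNash τ' γ' ∧ G.IsValue W := by
  refine ⟨⟨hτ', hγ', fun x τ hτ γ hγ => ⟨(h1 τ hτ x).trans (h2 γ' hγ' x),
    (h1 τ' hτ' x).trans (h2 γ hγ x)⟩⟩, ?_, ?_⟩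
  · ext x
    refine le_antisymm (ciSup_le fun τ => ?_) ?_
    · exact (ciInf_le (G.bddBelow_payoff τ x) ⟨γ', hγ'⟩).trans (h1 τ τ.2 x)
    · refine le_trans (le_ciInf fun γ : G.stoppingTimes => h2 γ γ.2 x)
        (le_ciSup (f := fun τ : G.stoppingTimes => ⨅ γ : G.stoppingTimes, G.payoff τ γ x)
          ⟨G.payoffBound, ?_⟩ ⟨τ', hτ'⟩)
      rintro _ ⟨τ, rfl⟩
      exact (ciInf_le (G.bddBelow_payoff τ x) ⟨γ', hγ'⟩).trans
        (abs_le.1 (G.abs_payoff_le τ γ' x)).2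
  · ext x
    refine le_antisymm ?_ (le_ciInf fun γ => ?_)
    · refine le_trans (ciInf_le (f := fun γ : G.stoppingTimes =>
        ⨆ τ : G.stoppingTimes, G.payoff τ γ x) ⟨-G.payoffBound, ?_⟩ ⟨γ', hγ'⟩)
          (ciSup_le fun τ : G.stoppingTimes => h1 τ τ.2 x)
      rintro _ ⟨γ, rfl⟩
      exact (abs_le.1 (G.abs_payoff_le τ' γ x)).1.trans
        (le_ciSup (G.bddAbove_payoff γ x) ⟨τ', hτ'⟩)
    · exact (h2 γ γ.2 x).trans (le_ciSup (G.bddAbove_payoff γ x) ⟨τ', hτ'⟩)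

/-! ### The inner loop -/

/-- Finiteness of `E` bounds the length of decreasing chains of subsets. This replaces every passage
to the limit in both loops. -/
lemma exists_forall_ge_eq_of_antitone {s : ℕ → Set E} (hs : Antitone s) :
    ∃ N, ∀ n, N ≤ n → s n = s N := by
  obtain ⟨N, hN⟩ := WellFoundedGT.monotone_chain_condition
    (⟨fun n => OrderDual.toDual (s n), fun _ _ h => hs h⟩ : ℕ →o (Set E)ᵒᵈ)
  exact ⟨N, fun n hn => (OrderDual.toDual.injective (hN n hn)).symm⟩

lemma antitone_innerD (S : Set E) : Antitone (G.innerD S) :=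
  antitone_nat_of_succ_le fun _ => Set.inter_subset_right

lemma disjoint_innerD (S : Set E) (n : ℕ) : Disjoint (G.innerD S n) S :=
  Set.disjoint_left.2 fun _ hx => (G.antitone_innerD S n.zero_le hx).2

/-- At the first stage `gen ψ` is positive off D ∪ S, so comparison puts ψ below the payoff, and
contact would contradict `gen_le_of_touch`. At later stages the points removed from D have positive
`gen` of the previous payoff: the same argument shows that the payoff increases everywhere and
strictly at the removed points. -/
lemma lt_payoff_innerD (S : Set E) (n : ℕ) (x : E) (hx : x ∉ G.innerD S n ∪ S) :
    G.ψ x < G.payoff (G.hit (G.innerD S n)) (G.hit S) x := by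
  induction n generalizing x with
  | zero =>
    obtain ⟨h1, h2, h3⟩ := G.payoff_hit_spec (G.disjoint_innerD S 0)
    have hgen : ∀ y, y ∉ G.innerD S 0 ∪ S → 0 < G.gen G.ψ y := fun y hy => by
      by_contra! h
      exact hy (Or.inl ⟨h, fun hS => hy (Or.inr hS)⟩)
    have hle : ∀ y, G.ψ y ≤ G.payoff (G.hit (G.innerD S 0)) (G.hit S) y :=
      G.le_of_gen_le (A := G.innerD S 0 ∪ S)
        (fun y hy => hy.elim (fun h => (h1 y h).ge) fun h => (G.ψ_le_φ y).trans (h2 y h).ge)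
        fun y hy => (h3 y hy).le.trans (hgen y hy).le
    refine lt_of_le_of_ne (hle x) fun h => ?_
    exact absurd (G.gen_le_of_touch hle h) (not_le.2 ((h3 x hx).le.trans_lt (hgen x hx)))
  | succ n ih =>
    obtain ⟨h1, h2, h3⟩ := G.payoff_hit_spec (G.disjoint_innerD S n)
    obtain ⟨h1', h2', h3'⟩ := G.payoff_hit_spec (G.disjoint_innerD S (n + 1))
    have hsub : G.innerD S (n + 1) ⊆ G.innerD S n := Set.inter_subset_right
    have hgen : ∀ y ∈ G.innerD S n, y ∉ G.innerD S (n + 1) →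
        0 < G.gen (G.payoff (G.hit (G.innerD S n)) (G.hit S)) y := fun y hy hy' => by
      by_contra! h
      exact hy' ⟨h, hy⟩
    have hle : ∀ y, G.payoff (G.hit (G.innerD S n)) (G.hit S) y ≤
        G.payoff (G.hit (G.innerD S (n + 1))) (G.hit S) y := by
      refine G.le_of_gen_le (A := G.innerD S (n + 1) ∪ S) ?_ ?_
      · rintro y (hy | hy)
        · rw [h1' y hy, h1 y (hsub hy)]
        · rw [h2' y hy, h2 y hy]
      · intro y hy
        rw [h3' y hy]
        by_cases hyn : y ∈ G.innerD S n
        · exact (hgen y hyn fun h => hy (Or.inl h)).le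
        · exact (h3 y fun h => h.elim hyn fun h => hy (Or.inr h)).ge
    by_cases hxn : x ∈ G.innerD S n
    · rw [← h1 x hxn]
      refine lt_of_le_of_ne (hle x) fun h => ?_
      have := G.gen_le_of_touch hle h
      rw [h3' x hx] at this
      exact absurd this (not_le.2 (hgen x hxn fun h => hx (Or.inl h)))
    · exact (ih x fun h => h.elim hxn fun h => hx (Or.inr h)).trans_le (hle x)

/-- The properties of the best reply `W` of the sup-player to the hitting time of `S`, attained at
the hitting time of `D`. -/
structure IsBestReply (S D : Set E) (W : E → ℝ) : Prop where
  eq_payoff : ∀ x, W x = G.payoff (G.hit D) (G.hit S) x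
  disjoint : Disjoint D S
  eq_ψ : ∀ x ∈ D, W x = G.ψ x
  eq_φ : ∀ x ∈ S, W x = G.φ x
  ψ_lt : ∀ x, x ∉ D ∪ S → G.ψ x < W x
  gen_le : ∀ x ∈ D, G.gen W x ≤ 0
  gen_eq : ∀ x, x ∉ D ∪ S → G.gen W x = 0

variable {G} in
lemma IsBestReply.ψ_le {S D : Set E} {W : E → ℝ} (h : G.IsBestReply S D W) (x : E) :
    G.ψ x ≤ W x := by
  by_cases hx : x ∈ D ∪ S
  · exact hx.elim (fun hx => (h.eq_ψ x hx).ge) fun hx => (G.ψ_le_φ x).trans (h.eq_φ x hx).ge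
  · exact (h.ψ_lt x hx).le

variable {G} in
lemma IsBestReply.gen_nonpos {S D : Set E} {W : E → ℝ} (h : G.IsBestReply S D W) (x : E)
    (hx : x ∉ S) : G.gen W x ≤ 0 := by
  by_cases hD : x ∈ D
  · exact h.gen_le x hD
  · exact (h.gen_eq x fun hx' => hx'.elim hD hx).le

/-- Where the inner loop is stationary, its payoff has `gen` ≤ 0 on D as well, hence off S. Being
above ψ and equal to φ on S, it dominates every reply to h(S), and it is itself attained by one. -/
lemma isBestReply_bestReply (S : Set E) : G.IsBestReply S (G.limitD S) (G.bestReply S) := by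
  obtain ⟨N, hN⟩ := exists_forall_ge_eq_of_antitone (G.antitone_innerD S)
  have hlim : G.limitD S = G.innerD S N := by
    refine Set.Subset.antisymm (Set.iInter_subset _ N) (Set.subset_iInter fun n => ?_)
    rcases le_total N n with h | h
    · exact (hN n h).ge
    · exact G.antitone_innerD S h
  have hgen : ∀ x ∈ G.innerD S N,
      G.gen (G.payoff (G.hit (G.innerD S N)) (G.hit S)) x ≤ 0 := fun x hx => by
    rw [← hN (N + 1) N.le_succ] at hx
    exact hx.1
  obtain ⟨h1, h2, h3⟩ := G.payoff_hit_spec (G.disjoint_innerD S N)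
  have hrep : G.IsBestReply S (G.innerD S N) (G.payoff (G.hit (G.innerD S N)) (G.hit S)) :=
    ⟨fun _ => rfl, G.disjoint_innerD S N, h1, h2, G.lt_payoff_innerD S N, hgen, h3⟩
  have heq : G.bestReply S = G.payoff (G.hit (G.innerD S N)) (G.hit S) :=
    funext fun x => le_antisymm
      (G.bestReply_le hrep.ψ_le (fun y hy => (h2 y hy).ge) hrep.gen_nonpos x)
      (G.payoff_le_bestReply S (G.hit_mem_stoppingTimes _) x)
  rw [hlim, heq]
  exact hrep

/-! ### The outer loop -/

/-- Sets from which the outer loop may be started. -/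
structure IsInitialSet (I : Set E) : Prop where
  eqSet_subset : G.eqSet ⊆ I
  φ_le : ∀ x ∈ I, G.φ x ≤ G.onePlayerValue x
  le_φ : ∀ x, x ∉ I → G.onePlayerValue x ≤ G.φ x

lemma ψ_le_onePlayerValue (x : E) : G.ψ x ≤ G.onePlayerValue x := by
  rw [onePlayerValue_eq]
  exact (G.isBestReply_bestReply ∅).ψ_le x

lemma isInitialSet_init : G.IsInitialSet G.init where
  eqSet_subset := Set.subset_union_right
  φ_le := by
    rintro x (hx | hx)
    · exact le_of_lt hx
    · exact (show G.φ x = G.ψ x from hx).le.trans (G.ψ_le_onePlayerValue x)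
  le_φ := fun x hx => not_lt.1 fun h => hx (Or.inl h)

lemma isInitialSet_init' : G.IsInitialSet G.init' where
  eqSet_subset := fun x hx => (show G.φ x = G.ψ x from hx).le.trans (G.ψ_le_onePlayerValue x)
  φ_le := fun _ hx => hx
  le_φ := fun _ hx => (not_le.1 hx).le

lemma isBestReply_fnV (I : Set E) (k : ℕ) : G.IsBestReply (G.setS I k) (G.setD I k) (G.fnV I k) :=
  G.isBestReply_bestReply _

/-- The properties of a set `S` at which the outer loop is stationary, with the corresponding best
reply. -/
structure IsStationary (S D : Set E) (W : E → ℝ) : Prop extends G.IsBestReply S D W where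
  eqSet_subset : G.eqSet ⊆ S
  le_φ : ∀ x, W x ≤ G.φ x
  gen_nonneg : ∀ x ∈ S, x ∉ G.eqSet → 0 ≤ G.gen W x

section Loop

variable {G} {I : Set E}

lemma IsInitialSet.eqSet_subset_setS (hI : G.IsInitialSet I) (k : ℕ) : G.eqSet ⊆ G.setS I k := by
  cases k with
  | zero => exact hI.eqSet_subset
  | succ k => exact Set.subset_union_right

lemma IsInitialSet.setS_succ_subset (hI : G.IsInitialSet I) (k : ℕ) : G.setS I (k + 1) ⊆ G.setS I k :=
  Set.union_subset Set.inter_subset_left (hI.eqSet_subset_setS k)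

lemma IsInitialSet.antitone_setS (hI : G.IsInitialSet I) : Antitone (G.setS I) :=
  antitone_nat_of_succ_le hI.setS_succ_subset

lemma gen_neg_of_notMem_setS_succ {k : ℕ} {x : E} (hx : x ∈ G.setS I k)
    (hx' : x ∉ G.setS I (k + 1)) : G.gen (G.fnV I k) x < 0 := by
  by_contra! h
  exact hx' (Or.inl ⟨hx, h⟩)

/-- The old best reply still dominates for the smaller set: at the points just dropped its `gen` is
negative, so it is superharmonic off the new set. -/
lemma IsInitialSet.fnV_succ_le (hI : G.IsInitialSet I) (k : ℕ) (x : E) : G.fnV I (k + 1) x ≤ G.fnV I k x := by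
  have h := G.isBestReply_fnV I k
  refine G.bestReply_le h.ψ_le (fun y hy => (h.eq_φ y (hI.setS_succ_subset k hy)).ge)
    (fun y hy => ?_) x
  by_cases hyk : y ∈ G.setS I k
  · exact (gen_neg_of_notMem_setS_succ hyk hy).le
  · exact h.gen_nonpos y hyk

lemma IsInitialSet.fnV_zero_le (hI : G.IsInitialSet I) (x : E) : G.fnV I 0 x ≤ G.onePlayerValue x := by
  have h := G.isBestReply_bestReply ∅
  rw [← onePlayerValue_eq] at h
  exact G.bestReply_le h.ψ_le hI.φ_le (fun y _ => h.gen_nonpos y (Set.notMem_empty y)) x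

lemma IsInitialSet.antitone_fnV (hI : G.IsInitialSet I) : Antitone (G.fnV I) :=
  antitone_nat_of_succ_le fun k x => hI.fnV_succ_le k x

/-- Monotonicity reduces this to the first iterate, which equals φ on I and is at most V₀ ≤ φ
elsewhere. -/
lemma IsInitialSet.fnV_le_φ (hI : G.IsInitialSet I) (k : ℕ) (x : E) : G.fnV I k x ≤ G.φ x := by
  refine (hI.antitone_fnV k.zero_le x).trans ?_
  by_cases hx : x ∈ I
  · exact ((G.isBestReply_fnV I 0).eq_φ x hx).le
  · exact (hI.fnV_zero_le x).trans (hI.le_φ x hx)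

/-- The only new case is a point x dropped from S at step k. In the new D the value is ψ < φ.
Otherwise `gen` of the new iterate is 0 at x, while `gen` of the old one, equal to φ there, is
negative; contact of the two ordered iterates at x would contradict `gen_le_of_touch`. -/
lemma IsInitialSet.fnV_lt_φ (hI : G.IsInitialSet I) (hlt : ∀ x, x ∉ I → G.onePlayerValue x < G.φ x) (k : ℕ) (x : E)
    (hx : x ∉ G.setS I k) : G.fnV I k x < G.φ x := by
  induction k with
  | zero => exact (hI.fnV_zero_le x).trans_lt (hlt x hx)
  | succ k ih =>
    by_cases hxk : x ∈ G.setS I k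
    · have h := G.isBestReply_fnV I (k + 1)
      by_cases hD : x ∈ G.setD I (k + 1)
      · rw [h.eq_ψ x hD]
        exact lt_of_le_of_ne (G.ψ_le_φ x) fun he => hx (hI.eqSet_subset_setS _ he.symm)
      · refine lt_of_le_of_ne (hI.fnV_le_φ _ x) fun he => ?_
        have ht := G.gen_le_of_touch (hI.fnV_succ_le k) (x := x)
          (he.trans ((G.isBestReply_fnV I k).eq_φ x hxk).symm)
        rw [h.gen_eq x fun h' => h'.elim hD hx] at ht
        exact absurd ht (not_le.2 (gen_neg_of_notMem_setS_succ hxk hx))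
    · exact (hI.fnV_succ_le k x).trans_lt (ih hxk)

/-- A point of D that left it would lie outside the new D ∪ S, where the new iterate exceeds ψ,
although the old and larger iterate equals ψ there. -/
lemma IsInitialSet.monotone_setD (hI : G.IsInitialSet I) : Monotone (G.setD I) := by
  refine monotone_nat_of_le_succ fun k x hx => ?_
  have h := G.isBestReply_fnV I k
  by_contra hx'
  have hxS : x ∉ G.setS I (k + 1) := fun hS =>
    Set.disjoint_left.1 h.disjoint hx (hI.setS_succ_subset k hS)
  have h1 := (G.isBestReply_fnV I (k + 1)).ψ_lt x fun h' => h'.elim hx' hxS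
  have h2 := hI.fnV_succ_le k x
  rw [h.eq_ψ x hx] at h2
  exact absurd h1 (not_lt.2 h2)

/-- The outer loop becomes stationary after finitely many steps. -/
lemma IsInitialSet.exists_stationary (hI : G.IsInitialSet I) :
    ∃ K, G.limS I = G.setS I K ∧ G.limD I = G.setD I K ∧
    G.limV I = G.fnV I K ∧ (∀ k, K ≤ k → G.fnV I k = G.fnV I K) ∧
    G.IsStationary (G.limS I) (G.limD I) (G.limV I) := by
  obtain ⟨K, hK⟩ := exists_forall_ge_eq_of_antitone hI.antitone_setS
  have hVK : ∀ k, K ≤ k → G.fnV I k = G.fnV I K := fun k hk => by rw [fnV, fnV, hK k hk]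
  have hDK : ∀ k, K ≤ k → G.setD I k = G.setD I K := fun k hk => by rw [setD, setD, hK k hk]
  have hS : G.limS I = G.setS I K :=
    Set.Subset.antisymm (Set.iInter_subset _ K) (Set.subset_iInter fun n =>
      (le_total K n).elim (fun h => (hK n h).ge) fun h => hI.antitone_setS h)
  have hD : G.limD I = G.setD I K :=
    Set.Subset.antisymm (Set.iUnion_subset fun n =>
      (le_total K n).elim (fun h => (hDK n h).le) fun h => hI.monotone_setD h)
      (Set.subset_iUnion _ K)
  have hlow : ∀ k x, G.fnV I K x ≤ G.fnV I k x := fun k x =>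
    (le_total K k).elim (fun h => (congrFun (hVK k h) x).ge) fun h => hI.antitone_fnV h x
  have hV : G.limV I = G.fnV I K := by
    ext x
    refine le_antisymm (ciInf_le ⟨G.fnV I K x, ?_⟩ K) (le_ciInf fun k => hlow k x)
    rintro _ ⟨k, rfl⟩
    exact hlow k x
  refine ⟨K, hS, hD, hV, hVK, ?_⟩
  rw [hS, hD, hV]
  refine ⟨G.isBestReply_fnV I K, hI.eqSet_subset_setS K, hI.fnV_le_φ K, fun x hx hxe => ?_⟩
  rw [← hK (K + 1) K.le_succ] at hx
  exact hx.elim (fun h => h.2) fun h => absurd h hxe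

end Loop

/-! ### Saddle point and value at a stationary set -/

variable {G} in
lemma IsStationary.isNash_and_isValue {S D : Set E} {W : E → ℝ} (h : G.IsStationary S D W) :
    G.IsNash (G.hit (G.eqSet ∪ D)) (G.hit S) ∧ G.IsValue W := by
  refine G.isNash_and_isValue (G.hit_mem_stoppingTimes _) (G.hit_mem_stoppingTimes _)
    (fun τ hτ x => ?_) fun γ hγ x => ?_
  · exact G.payoff_le hτ (G.hit_mem_stoppingTimes S)
      (fun _ _ _ hs => h.gen_nonpos _ (G.notMem_of_lt_hit hs)) (fun _ _ _ _ => h.ψ_le _)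
      (fun _ _ ht _ => (h.eq_φ _ (G.mem_of_hit_eq ht)).ge) x
  -- The sup-player must also stop on {φ = ψ}: this set lies in S, but stationarity gives no sign of
  -- `gen W` on it. Stopping there loses nothing, since W ≤ φ = ψ.
  · refine G.le_payoff (G.hit_mem_stoppingTimes _) hγ (fun ω s hs _ => ?_) (fun ω t ht _ => ?_)
      (fun _ _ _ _ => h.le_φ _) x
    · have hn := G.notMem_of_lt_hit hs
      by_cases hS : G.X s ω ∈ S
      · exact h.gen_nonneg _ hS fun he => hn (Or.inl he)
      · exact (h.gen_eq _ fun h' => h'.elim (fun hD => hn (Or.inr hD)) hS).ge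
    · rcases G.mem_of_hit_eq ht with he | hD
      · exact (h.le_φ _).trans (show G.φ _ = G.ψ _ from he).le
      · exact (h.eq_ψ _ hD).le

-- D is determined by W alone. Hence two stationary configurations, which share W as the value of
-- the game, also share D.
variable {G} in
lemma IsStationary.mem_D_iff {S D : Set E} {W : E → ℝ} (h : G.IsStationary S D W) (x : E) :
    x ∈ D ↔ W x = G.ψ x ∧ x ∉ G.eqSet := by
  refine ⟨fun hx => ⟨h.eq_ψ x hx, fun he =>
    Set.disjoint_left.1 h.disjoint hx (h.eqSet_subset he)⟩, fun ⟨hx, he⟩ => ?_⟩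
  by_contra hD
  by_cases hS : x ∈ S
  · exact he ((h.eq_φ x hS).symm.trans hx)
  · exact (h.ψ_lt x fun h' => h'.elim hD hS).ne' hx

variable {G} in
lemma IsStationary.union_eqSet {S D : Set E} {W : E → ℝ} (h : G.IsStationary S D W) :
    D ∪ G.eqSet = {x | W x = G.ψ x} := by
  ext x
  rw [Set.mem_union, h.mem_D_iff, Set.mem_ofPred_eq]
  by_cases he : x ∈ G.eqSet
  · have := (h.eq_φ x (h.eqSet_subset he)).trans (show G.φ x = G.ψ x from he)
    simp [he, this]
  · simp [he]

lemma init_subset_init' : G.init ⊆ G.init' := G.isInitialSet_init.φ_le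

end

end StoppingGame

theorem proposition3p9 {E Ω : Type*} [Fintype E] [MeasurableSpace E]
    [DiscreteMeasurableSpace E] [MeasurableSpace Ω] (G : StoppingGame E Ω)
    -- the sets and functions of the algorithm restarted from `{V_0 ≥ φ}`, and their limits
    (S D : ℕ → Set E) (W : ℕ → E → ℝ) (Sinf Dinf : Set E) (Winf : E → ℝ)
    (hS : S = G.setS G.init') (hD : D = G.setD G.init') (hW : W = G.fnV G.init')
    (hSinf : Sinf = G.limS G.init') (hDinf : Dinf = G.limD G.init')
    (hWinf : Winf = G.limV G.init') :
    ∃ V : E → ℝ, G.IsValue V ∧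
    G.init ⊆ G.init' ∧
    -- the properties of each iteration
    (∀ k,
      (∀ x, W k x = G.payoff (G.hit (D k)) (G.hit (S k)) x) ∧
      Disjoint (D k) (S k) ∧
      (∀ x ∈ D k, W k x = G.ψ x) ∧
      (∀ x ∈ S k, W k x = G.φ x) ∧
      (∀ x, x ∉ D k ∪ S k → G.ψ x < W k x) ∧
      (∀ x ∈ D k, G.gen (W k) x ≤ 0) ∧
      (∀ x, x ∉ D k ∪ S k → G.gen (W k) x = 0) ∧
      (∀ x, G.ψ x ≤ W (k + 1) x ∧ W (k + 1) x ≤ W k x ∧ W k x ≤ G.φ x)) ∧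
    Monotone D ∧ Antitone S ∧
    -- the same properties in the limit
    (∀ x, Tendsto (fun k => W k x) atTop (𝓝 (Winf x))) ∧
    (∀ x, Winf x = G.payoff (G.hit Dinf) (G.hit Sinf) x) ∧
    Disjoint Dinf Sinf ∧
    (∀ x, x ∉ Dinf ∪ Sinf → G.ψ x < Winf x) ∧
    (∀ x ∈ Dinf, G.gen Winf x ≤ 0) ∧
    (∀ x, x ∉ Dinf ∪ Sinf → G.gen Winf x = 0) ∧
    (∀ x, G.ψ x ≤ Winf x ∧ Winf x ≤ G.φ x) ∧
    -- the Nash equilibrium, and the values of the limit function on the limit sets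
    G.IsNash (fun ω => min (G.hit Dinf ω) (G.hit G.eqSet ω)) (G.hit Sinf) ∧
    (fun ω => min (G.hit Dinf ω) (G.hit G.eqSet ω)) = G.hit (G.eqSet ∪ Dinf) ∧
    (∀ x ∈ Sinf, Winf x = G.φ x) ∧
    (∀ x ∈ Dinf, Winf x = G.ψ x ∧ G.ψ x < G.φ x) ∧
    -- comparison with the original algorithm and with the value of the game
    Dinf = G.limD G.init ∧
    Dinf ∪ G.eqSet = {x | V x = G.ψ x} ∧
    G.hit Dinf = G.hit (G.limD G.init) ∧
    Winf = G.limV G.init ∧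
    Winf = V ∧
    -- strict bounds for every iteration and in the limit
    (∀ k x, x ∉ S k → W k x < G.φ x) ∧
    (∀ x, x ∉ Sinf → Winf x < G.φ x) ∧
    (∀ k x, x ∉ D k ∪ S k → G.ψ x < W k x ∧ W k x < G.φ x) ∧
    (∀ x, x ∉ Dinf ∪ Sinf → G.ψ x < Winf x ∧ Winf x < G.φ x) ∧
    Sinf = {x | V x = G.φ x} := by
  subst hS hD hW hSinf hDinf hWinf
  have hI := G.isInitialSet_init'
  -- The strict inequality that the modified start provides; outside {V₀ > φ} ∪ {φ = ψ} only V₀ ≤ φ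
  -- is available.
  have hlt : ∀ x, x ∉ G.init' → G.onePlayerValue x < G.φ x := fun x hx => not_le.1 hx
  obtain ⟨K, hSK, -, hVK, hstab, hst⟩ := hI.exists_stationary
  obtain ⟨-, -, -, -, -, hst'⟩ := G.isInitialSet_init.exists_stationary
  obtain ⟨hN, hval⟩ := hst.isNash_and_isValue
  -- Both limits are equal to the lower value of the game.
  have hV : G.limV G.init' = G.limV G.init := hval.1.symm.trans hst'.isNash_and_isValue.2.1
  have hD : G.limD G.init' = G.limD G.init := by
    ext x
    rw [hst.mem_D_iff, hst'.mem_D_iff, hV]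
  have hmin : (fun ω => min (G.hit (G.limD G.init') ω) (G.hit G.eqSet ω)) =
      G.hit (G.eqSet ∪ G.limD G.init') := by
    ext1 ω
    rw [StoppingGame.hit_union, min_comm]
  have hltS : ∀ x, x ∉ G.limS G.init' → G.limV G.init' x < G.φ x := by
    rw [hSK, hVK]
    exact hI.fnV_lt_φ hlt K
  refine ⟨G.limV G.init', hval, G.init_subset_init', fun k => ?_, hI.monotone_setD,
    hI.antitone_setS, fun x => ?_, hst.eq_payoff, hst.disjoint, hst.ψ_lt, hst.gen_le, hst.gen_eq,
    fun x => ⟨hst.ψ_le x, hst.le_φ x⟩, hmin ▸ hN, hmin, hst.eq_φ, fun x hx => ⟨hst.eq_ψ x hx, ?_⟩,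
    hD, hst.union_eqSet, congrArg G.hit hD, hV, rfl, hI.fnV_lt_φ hlt, hltS,
    fun k x hx => ⟨(G.isBestReply_fnV _ k).ψ_lt x hx,
      hI.fnV_lt_φ hlt k x fun h => hx (Or.inr h)⟩,
    fun x hx => ⟨hst.ψ_lt x hx, hltS x fun h => hx (Or.inr h)⟩, ?_⟩
  · have h := G.isBestReply_fnV G.init' k
    exact ⟨h.eq_payoff, h.disjoint, h.eq_ψ, h.eq_φ, h.ψ_lt, h.gen_le, h.gen_eq, fun x =>
      ⟨(G.isBestReply_fnV G.init' (k + 1)).ψ_le x, hI.fnV_succ_le k x, hI.fnV_le_φ k x⟩⟩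
  · refine tendsto_const_nhds.congr' ?_
    filter_upwards [eventually_ge_atTop K] with k hk
    rw [hVK, hstab k hk]
  · exact lt_of_le_of_ne (G.ψ_le_φ x) fun he => ((hst.mem_D_iff x).1 hx).2 he.symm
  · ext x
    exact ⟨hst.eq_φ x, fun hx => by_contra fun h => (hltS x h).ne hx⟩
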